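/- Let $(a_n)_{n\ge 0}$ be a sequence of complex numbers such that the power series $g(z)=\sum_{n=0}^{\infty}a_nz^n$ converges for $|z|<1$. Let $(d_k)_{k\ge 1}$ be real numbers for which there are constants $d^-,d^+$ with $0<d^-\le d_k\le d^+$ for all $k\ge 1$, and let the real sequence $(p_j)_{j\ge 0}$ be defined by its generating function $$p(z)=\sum_{j=0}^{\infty}p_jz^j=\exp\Bigl\{\sum_{k=1}^{\infty}\frac{d_k}{k}z^k\Bigr\},\qquad |z|<1$$ (so that $p_j>0$ for all $j$). Then, for every $A\in\mathbb{C}$, the relation $$\lim_{n\to\infty}\frac{1}{p_n}\sum_{k=0}^{n}a_kp_{n-k}=A$$ holds if and only if the following two conditions are both satisfied: 1. $\displaystyle\lim_{x\uparrow 1}g(x)=A$, where $x$ is real; 2. $\displaystyle\sum_{k=0}^{n}k\,a_k\,p_{n-k}=o(np_n)$ as $n\to\infty$. -/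

import Mathlib

open Filter Topology Asymptotics

/-!
The Voronoi means `u` of `a` satisfy
`n p_n u_n = ∑_{j < n} d_{n - j} p_j u_j + ∑_{k ≤ n} k a_k p_{n - k}`. Condition 2 therefore says
that `u` is almost harmonic for the Markov chain that jumps from `n` to `j < n` with probability
`d_{n - j} p_j / (n p_n)`. The bounds on `d` give a Doeblin minorization of this chain by the
weights `p`, so that the deviation of `u` from a suitable center contracts each time the block
`[0, K ^ i)` is enlarged to `[0, K ^ (i + 1))`, and `u` ends up close to a center `m_i` on the
`i`-th block. The power mean `g x = (∑ p_j x ^ j u_j) / ∑ p_j x ^ j` at `x = 1 - 1 / (2 K ^ i)`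
sees little besides that block, so it is close to `m_i` as well, and `g x → A` forces `u_n → A`.
The converse is the Abelian direction.
-/

section PowerSeries

variable {E : Type*} [NormedAddCommGroup E] [NormedSpace ℝ E]

theorem summable_norm_pow_smul_of_lt {a : ℕ → E} {x r : ℝ} (hx : 0 ≤ x) (hxr : x < r)
    (hr : Summable fun n => r ^ n • a n) : Summable fun n => ‖x ^ n • a n‖ := by
  have hr0 : 0 < r := hx.trans_lt hxr
  obtain ⟨M, hM⟩ := hr.tendsto_atTop_zero.norm.bddAbove_range
  refine Summable.of_nonneg_of_le (fun n => norm_nonneg _) (fun n => ?_)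
    ((summable_geometric_of_lt_one (div_nonneg hx hr0.le) ((div_lt_one hr0).2 hxr)).mul_right M)
  calc ‖x ^ n • a n‖ = (x / r) ^ n * ‖r ^ n • a n‖ := by
        rw [← Real.norm_of_nonneg (pow_nonneg (div_nonneg hx hr0.le) n), ← norm_smul, smul_smul,
          ← mul_pow, div_mul_cancel₀ x hr0.ne']
    _ ≤ (x / r) ^ n * M :=
        mul_le_mul_of_nonneg_left (hM ⟨n, rfl⟩) (pow_nonneg (div_nonneg hx hr0.le) n)

theorem hasSum_sum_range_smul_of_summable_norm [CompleteSpace E] {f : ℕ → ℝ} {v : ℕ → E} {s : ℝ}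
    {t : E} (hf : HasSum f s) (hv : HasSum v t) (hvn : Summable fun n => ‖v n‖) :
    HasSum (fun n => ∑ k ∈ Finset.range (n + 1), f (n - k) • v k) (s • t) := by
  have hprod : HasSum (fun x : ℕ × ℕ => f x.1 • v x.2) (s • t) := by
    refine hf.smul hv (Summable.of_norm ?_)
    simpa only [norm_smul] using
      hf.summable.norm.mul_of_nonneg hvn (fun _ => norm_nonneg _) fun _ => norm_nonneg _
  have hswap : HasSum (fun x : ℕ × ℕ => f x.2 • v x.1) (s • t) :=
    (Equiv.prodComm ℕ ℕ).hasSum_iff.2 hprod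
  refine ((Finset.HasAntidiagonal.sigmaAntidiagonalEquivProd.hasSum_iff.2 hswap).sigma
    fun n => hasSum_fintype _).congr_fun fun n => ?_
  rw [← Finset.Nat.sum_antidiagonal_eq_sum_range_succ fun k l => f l • v k]
  exact (Finset.sum_finset_coe (fun kl : ℕ × ℕ => f kl.2 • v kl.1) _).symm

theorem hasSum_partialSum_mul_pow {p : ℕ → ℝ} (hp : ∀ j, 0 ≤ p j) {x s : ℝ} (hx0 : 0 ≤ x)
    (hx1 : x < 1) (hs : HasSum (fun j => p j * x ^ j) s) :
    HasSum (fun j => (∑ k ∈ Finset.range (j + 1), p k) * x ^ j) (s * (1 - x)⁻¹) := by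
  have hgeom := hasSum_geometric_of_lt_one hx0 hx1
  have hprod := hasSum_sum_range_mul_of_summable_norm
    (hs.summable.congr fun j => (Real.norm_of_nonneg (mul_nonneg (hp j) (pow_nonneg hx0 j))).symm)
    (hgeom.summable.congr fun j => (Real.norm_of_nonneg (pow_nonneg hx0 j)).symm)
  rw [hs.tsum_eq, hgeom.tsum_eq] at hprod
  refine hprod.congr_fun fun j => ?_
  rw [Finset.sum_mul]
  refine Finset.sum_congr rfl fun k hk => ?_
  rw [mul_assoc, ← pow_add, Nat.add_sub_cancel' (Nat.lt_succ_iff.1 (Finset.mem_range.1 hk))]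

theorem mul_norm_sub_le_of_hasSum {w b : ℕ → ℝ} {u : ℕ → E} {F B : ℝ} {G m : E} {N : ℕ}
    (hw : ∀ j, 0 ≤ w j) (hF : HasSum w F)
    (hG : HasSum (fun j => w j • u j) (F • G)) (hb : ∀ j, 0 ≤ b j) (hB : HasSum b B)
    (hle : ∀ j, N ≤ j → w j * ‖u j - m‖ ≤ b j) :
    F * ‖G - m‖ ≤ ∑ j ∈ Finset.range N, w j * ‖u j - m‖ + B := by
  have hdiff : HasSum (fun j => w j • (u j - m)) (F • (G - m)) := by
    simpa only [smul_sub] using hG.sub (hF.smul_const m)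
  have hhead : HasSum (fun j => if j ∈ Finset.range N then w j * ‖u j - m‖ else 0)
      (∑ j ∈ Finset.range N, w j * ‖u j - m‖) := by
    rw [← Finset.sum_congr rfl fun j hj => if_pos hj]
    exact hasSum_sum_of_ne_finset_zero fun j hj => if_neg hj
  calc F * ‖G - m‖ = ‖F • (G - m)‖ := by
        rw [norm_smul, Real.norm_of_nonneg (hF.nonneg hw)]
    _ ≤ ∑ j ∈ Finset.range N, w j * ‖u j - m‖ + B := by
        refine hdiff.norm_le_of_bounded (hhead.add hB) fun j => ?_
        rw [norm_smul, Real.norm_of_nonneg (hw j)]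
        split_ifs with hj
        · exact le_add_of_nonneg_right (hb j)
        · rw [zero_add]
          exact hle j (by simpa using hj)

theorem one_sub_inv_two_mul_bounds {L : ℕ} (hL : 1 ≤ L) :
    0 ≤ 1 - (2 * (L : ℝ))⁻¹ ∧ 1 - (2 * (L : ℝ))⁻¹ < 1 ∧ 1 / 2 ≤ (1 - (2 * (L : ℝ))⁻¹) ^ L := by
  have hL1 : (1 : ℝ) ≤ L := by exact_mod_cast hL
  have hinv : (2 * (L : ℝ))⁻¹ ≤ 1 := inv_le_one_of_one_le₀ (by linarith)
  refine ⟨sub_nonneg.2 hinv, sub_lt_self _ (by positivity), ?_⟩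
  have hbernoulli := one_add_mul_le_pow (a := -(2 * (L : ℝ))⁻¹) (by linarith) L
  rw [← sub_eq_add_neg] at hbernoulli
  refine le_trans (le_of_eq ?_) hbernoulli
  field_simp
  norm_num

end PowerSeries

section Exponential

theorem hasFPowerSeriesAt_ofScalars {a : ℕ → ℂ} {f : ℂ → ℂ}
    (hf : ∀ᶠ z in 𝓝 0, HasSum (fun n => a n * z ^ n) (f z)) :
    HasFPowerSeriesAt f (FormalMultilinearSeries.ofScalars ℂ a) 0 := by
  rw [hasFPowerSeriesAt_iff]
  filter_upwards [hf] with z hz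
  simpa only [zero_add, FormalMultilinearSeries.coeff_ofScalars, smul_eq_mul, mul_comm] using hz

theorem iteratedDeriv_eq_factorial_mul {a : ℕ → ℂ} {f : ℂ → ℂ}
    (hf : HasFPowerSeriesAt f (FormalMultilinearSeries.ofScalars ℂ a) 0) (n : ℕ) :
    iteratedDeriv n f 0 = n.factorial * a n := by
  have hcoeff := congrArg (fun q => FormalMultilinearSeries.coeff q n)
    (hf.eq_formalMultilinearSeries hf.analyticAt.hasFPowerSeriesAt)
  simp only [FormalMultilinearSeries.coeff_ofScalars] at hcoeff
  rw [hcoeff, mul_div_cancel₀ _ (Nat.cast_ne_zero.2 n.factorial_ne_zero)]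

theorem coeff_exp_recursion {b e : ℕ → ℂ} {D : ℂ → ℂ}
    (hD : ∀ᶠ z in 𝓝 0, HasSum (fun n => e n * z ^ n) (D z))
    (hf : ∀ᶠ z in 𝓝 0, HasSum (fun n => b n * z ^ n) (Complex.exp (D z))) (n : ℕ) :
    ((n + 1 : ℕ) : ℂ) * b (n + 1)
      = ∑ k ∈ Finset.range (n + 1), ((k + 1 : ℕ) : ℂ) * e (k + 1) * b (n - k) := by
  set f : ℂ → ℂ := fun z => Complex.exp (D z)
  have hDs := hasFPowerSeriesAt_ofScalars hD
  have hfs : HasFPowerSeriesAt f (FormalMultilinearSeries.ofScalars ℂ b) 0 :=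
    hasFPowerSeriesAt_ofScalars hf
  have hderiv : deriv f =ᶠ[𝓝 0] fun z => deriv D z * f z := by
    filter_upwards [hDs.analyticAt.eventually_analyticAt] with z hz
    rw [hz.differentiableAt.hasDerivAt.cexp.deriv, mul_comm]
  have hleibniz : (n.factorial : ℂ) * (((n + 1 : ℕ) : ℂ) * b (n + 1)) =
      ∑ k ∈ Finset.range (n + 1),
        (n.choose k : ℂ) * iteratedDeriv k (deriv D) 0 * iteratedDeriv (n - k) f 0 := by
    rw [← iteratedDeriv_fun_mul hDs.analyticAt.deriv.contDiffAt hfs.analyticAt.contDiffAt,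
      ← hderiv.iteratedDeriv_eq n, ← iteratedDeriv_succ', iteratedDeriv_eq_factorial_mul hfs,
      Nat.factorial_succ]
    push_cast
    ring
  refine mul_left_cancel₀ (Nat.cast_ne_zero.2 n.factorial_ne_zero) (hleibniz.trans ?_)
  rw [Finset.mul_sum]
  refine Finset.sum_congr rfl fun k hk => ?_
  rw [← iteratedDeriv_succ', iteratedDeriv_eq_factorial_mul hDs, iteratedDeriv_eq_factorial_mul hfs,
    ← Nat.choose_mul_factorial_mul_factorial (Nat.lt_succ_iff.1 (Finset.mem_range.1 hk)),
    Nat.factorial_succ]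
  push_cast
  ring

theorem hasSum_div_mul_pow {d : ℕ → ℝ} {C : ℝ} (hd : ∀ k, 1 ≤ k → |d k| ≤ C) {z : ℂ}
    (hz : ‖z‖ < 1) :
    HasSum (fun n : ℕ => (d n : ℂ) / (n : ℂ) * z ^ n)
      (∑' k : ℕ, (d (k + 1) : ℂ) / ((k + 1 : ℕ) : ℂ) * z ^ (k + 1)) := by
  rw [← hasSum_nat_add_iff' 1]
  simp only [Finset.sum_range_one, Nat.cast_zero, div_zero, zero_mul, sub_zero]
  refine (Summable.of_norm_bounded
    ((summable_geometric_of_lt_one (norm_nonneg z) hz).mul_left C) fun k => ?_).hasSum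
  have hdk := hd (k + 1) k.succ_pos
  rw [norm_mul, norm_div, Complex.norm_real, Complex.norm_natCast, norm_pow, Real.norm_eq_abs]
  refine mul_le_mul ((div_le_self (abs_nonneg _) ?_).trans hdk)
    (pow_le_pow_of_le_one (norm_nonneg z) hz.le k.le_succ) (by positivity)
    ((abs_nonneg _).trans hdk)
  exact_mod_cast k.succ_pos

theorem coeff_zero_eq_of_hasSum {p : ℕ → ℂ} {s : ℂ} (hp : HasSum (fun j => p j * 0 ^ j) s) :
    p 0 = s := by
  have hsingle : HasSum (fun j => p j * 0 ^ j) (p 0 * 0 ^ 0) :=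
    hasSum_single 0 fun j hj => by rw [zero_pow hj, mul_zero]
  simpa only [pow_zero, mul_one] using hsingle.unique hp

end Exponential

/-- Positive weights `p` governed by the recursion `n p_n = ∑_{j < n} d_{n - j} p_j`, which is the
coefficient form of `z p'(z) = p(z) ∑ d_k z^k`, where `d` takes values in `[c, C]`. The value `d 0`
never enters. -/
structure RenewalWeights (d p : ℕ → ℝ) (c C : ℝ) : Prop where
  lower_pos : 0 < c
  bounds : ∀ k : ℕ, 1 ≤ k → c ≤ d k ∧ d k ≤ C
  zero_pos : 0 < p 0
  recursion : ∀ n : ℕ, (n : ℝ) * p n = ∑ j ∈ Finset.range n, d (n - j) * p j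

namespace RenewalWeights

theorem of_hasSum_exp {d p : ℕ → ℝ} {c C : ℝ} (hc : 0 < c)
    (hd : ∀ k : ℕ, 1 ≤ k → c ≤ d k ∧ d k ≤ C)
    (hp : ∀ z : ℂ, ‖z‖ < 1 →
      HasSum (fun j : ℕ => (p j : ℂ) * z ^ j)
        (Complex.exp (∑' k : ℕ, (d (k + 1) : ℂ) / ((k + 1 : ℕ) : ℂ) * z ^ (k + 1)))) :
    RenewalWeights d p c C := by
  have hunit : ∀ᶠ z in 𝓝 (0 : ℂ), ‖z‖ < 1 :=
    continuous_norm.continuousAt.eventually_lt_const (by simp)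
  have hlog : ∀ᶠ z in 𝓝 (0 : ℂ), HasSum (fun n : ℕ => (d n : ℂ) / (n : ℂ) * z ^ n)
      (∑' k : ℕ, (d (k + 1) : ℂ) / ((k + 1 : ℕ) : ℂ) * z ^ (k + 1)) :=
    hunit.mono fun z => hasSum_div_mul_pow fun k hk =>
      (abs_of_nonneg (hc.le.trans (hd k hk).1)).trans_le (hd k hk).2
  have hp0 : p 0 = 1 := by
    have hzero := coeff_zero_eq_of_hasSum (hp 0 (by simp))
    simpa using hzero
  refine ⟨hc, hd, by rw [hp0]; exact one_pos, fun n => ?_⟩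
  rcases n with _ | n
  · simp
  have hrec : ((n + 1 : ℕ) : ℝ) * p (n + 1)
      = ∑ k ∈ Finset.range (n + 1), d (k + 1) * p (n - k) := by
    have hcoeff := coeff_exp_recursion hlog (hunit.mono hp) n
    simp only [mul_div_cancel₀ _ (Nat.cast_ne_zero (R := ℂ).2 (Nat.succ_ne_zero _))] at hcoeff
    exact_mod_cast hcoeff
  rw [hrec, ← Finset.sum_range_reflect]
  refine Finset.sum_congr rfl fun j hj => ?_
  have hjn := Finset.mem_range.1 hj
  congr 2 <;> lia

open Finset

section Weights

variable {d p : ℕ → ℝ} {c C : ℝ}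

theorem lower_le_upper (h : RenewalWeights d p c C) : c ≤ C :=
  (h.bounds 1 le_rfl).1.trans (h.bounds 1 le_rfl).2

theorem upper_pos (h : RenewalWeights d p c C) : 0 < C :=
  h.lower_pos.trans_le h.lower_le_upper

theorem lower_le_coeff (h : RenewalWeights d p c C) {j n : ℕ} (hj : j < n) : c ≤ d (n - j) :=
  (h.bounds _ (Nat.sub_pos_of_lt hj)).1

theorem coeff_le_upper (h : RenewalWeights d p c C) {j n : ℕ} (hj : j < n) : d (n - j) ≤ C :=
  (h.bounds _ (Nat.sub_pos_of_lt hj)).2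

theorem coeff_pos (h : RenewalWeights d p c C) {j n : ℕ} (hj : j < n) : 0 < d (n - j) :=
  h.lower_pos.trans_le (h.lower_le_coeff hj)

theorem pos (h : RenewalWeights d p c C) (n : ℕ) : 0 < p n := by
  induction n using Nat.strong_induction_on with
  | _ n ih =>
    rcases Nat.eq_zero_or_pos n with rfl | hn
    · exact h.zero_pos
    · refine pos_of_mul_pos_right (a := (n : ℝ)) ?_ n.cast_nonneg
      rw [h.recursion]
      exact sum_pos (fun j hj => mul_pos (h.coeff_pos (mem_range.1 hj)) (ih j (mem_range.1 hj)))
        ⟨0, mem_range.2 hn⟩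

theorem coeff_mul_pos (h : RenewalWeights d p c C) {j n : ℕ} (hj : j < n) :
    0 < d (n - j) * p j :=
  mul_pos (h.coeff_pos hj) (h.pos j)

theorem partialSum_pos (h : RenewalWeights d p c C) {n : ℕ} (hn : 1 ≤ n) :
    0 < ∑ j ∈ range n, p j :=
  sum_pos (fun j _ => h.pos j) ⟨0, mem_range.2 hn⟩

theorem partialSum_mono (h : RenewalWeights d p c C) : Monotone fun n => ∑ j ∈ range n, p j :=
  fun _ _ hmn => sum_le_sum_of_subset_of_nonneg (range_mono hmn) fun j _ _ => (h.pos j).le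

theorem lower_mul_partialSum_le (h : RenewalWeights d p c C) {L n : ℕ} (hLn : L ≤ n) :
    c * ∑ j ∈ range L, p j ≤ ∑ j ∈ range L, d (n - j) * p j := by
  rw [mul_sum]
  exact sum_le_sum fun j hj => mul_le_mul_of_nonneg_right
    (h.lower_le_coeff ((mem_range.1 hj).trans_le hLn)) (h.pos j).le

theorem le_upper_mul_partialSum (h : RenewalWeights d p c C) {L n : ℕ} (hLn : L ≤ n) :
    ∑ j ∈ range L, d (n - j) * p j ≤ C * ∑ j ∈ range L, p j := by
  rw [mul_sum]
  exact sum_le_sum fun j hj => mul_le_mul_of_nonneg_right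
    (h.coeff_le_upper ((mem_range.1 hj).trans_le hLn)) (h.pos j).le

theorem lower_mul_partialSum_le_mul (h : RenewalWeights d p c C) (n : ℕ) :
    c * ∑ j ∈ range n, p j ≤ n * p n :=
  (h.lower_mul_partialSum_le le_rfl).trans_eq (h.recursion n).symm

theorem mul_le_upper_mul_partialSum (h : RenewalWeights d p c C) (n : ℕ) :
    n * p n ≤ C * ∑ j ∈ range n, p j :=
  (h.recursion n).trans_le (h.le_upper_mul_partialSum le_rfl)

theorem partialSum_doubling (h : RenewalWeights d p c C) {L : ℕ} (hL : 1 ≤ L) :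
    (1 + c / 2) * ∑ j ∈ range L, p j ≤ ∑ j ∈ range (2 * L), p j := by
  have : (0 : ℝ) < L := by exact_mod_cast hL
  have hterm : ∀ i ∈ range L, c * (∑ j ∈ range L, p j) / (2 * L) ≤ p (L + i) := by
    intro i hi
    have hi' : ((L + i : ℕ) : ℝ) ≤ 2 * L := by
      have := mem_range.1 hi
      exact_mod_cast (show L + i ≤ 2 * L by lia)
    rw [div_le_iff₀' (by positivity)]
    calc c * ∑ j ∈ range L, p j ≤ c * ∑ j ∈ range (L + i), p j :=
          mul_le_mul_of_nonneg_left (h.partialSum_mono (Nat.le_add_right L i)) h.lower_pos.le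
      _ ≤ ((L + i : ℕ) : ℝ) * p (L + i) := h.lower_mul_partialSum_le_mul _
      _ ≤ 2 * L * p (L + i) := mul_le_mul_of_nonneg_right hi' (h.pos _).le
  calc (1 + c / 2) * ∑ j ∈ range L, p j
      = ∑ j ∈ range L, p j + ∑ _i ∈ range L, c * (∑ j ∈ range L, p j) / (2 * L) := by
        rw [sum_const, card_range, nsmul_eq_mul]
        field_simp
    _ ≤ ∑ j ∈ range L, p j + ∑ i ∈ range L, p (L + i) := by gcongr with i hi; exact hterm i hi
    _ = ∑ j ∈ range (2 * L), p j := by rw [two_mul, sum_range_add]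

theorem pow_mul_partialSum_le (h : RenewalWeights d p c C) {L : ℕ} (hL : 1 ≤ L) (t : ℕ) :
    (1 + c / 2) ^ t * ∑ j ∈ range L, p j ≤ ∑ j ∈ range (L * 2 ^ t), p j := by
  have hc := h.lower_pos
  induction t with
  | zero => simp
  | succ t ih =>
    calc (1 + c / 2) ^ (t + 1) * ∑ j ∈ range L, p j
        = (1 + c / 2) * ((1 + c / 2) ^ t * ∑ j ∈ range L, p j) := by ring
      _ ≤ (1 + c / 2) * ∑ j ∈ range (L * 2 ^ t), p j := by gcongr
      _ ≤ ∑ j ∈ range (2 * (L * 2 ^ t)), p j :=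
          h.partialSum_doubling (Nat.mul_pos hL (by positivity))
      _ = ∑ j ∈ range (L * 2 ^ (t + 1)), p j := by
          rw [show 2 * (L * 2 ^ t) = L * 2 ^ (t + 1) by ring]

theorem exists_partialSum_le_mul (h : RenewalWeights d p c C) {q : ℝ} (hq : 0 < q) :
    ∃ K : ℕ, 2 ≤ K ∧ ∀ L : ℕ, 1 ≤ L → ∑ j ∈ range L, p j ≤ q * ∑ j ∈ range (L * K), p j := by
  have hc := h.lower_pos
  obtain ⟨t, ht⟩ := pow_unbounded_of_one_lt q⁻¹ (show 1 < 1 + c / 2 by linarith)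
  refine ⟨2 ^ (t + 1), Nat.le_self_pow t.succ_ne_zero 2, fun L hL => ?_⟩
  rw [← inv_mul_le_iff₀ hq]
  refine le_trans ?_ (h.pow_mul_partialSum_le hL (t + 1))
  gcongr
  · exact (h.partialSum_pos hL).le
  · exact ht.le.trans (pow_le_pow_right₀ (by linarith) t.le_succ)

theorem tendsto_partialSum_atTop (h : RenewalWeights d p c C) :
    Tendsto (fun n => ∑ j ∈ range n, p j) atTop atTop := by
  refine tendsto_atTop_atTop_of_monotone h.partialSum_mono fun b => ?_
  have hb : 0 < |b| + 1 := by positivity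
  obtain ⟨K, -, hK⟩ := h.exists_partialSum_le_mul (div_pos h.zero_pos hb)
  have hK1 := hK 1 le_rfl
  rw [sum_range_one, one_mul, div_mul_eq_mul_div, le_div_iff₀ hb] at hK1
  exact ⟨K, (le_abs_self b).trans ((le_add_of_nonneg_right zero_le_one).trans
    (le_of_mul_le_mul_left hK1 h.zero_pos))⟩

theorem partialSum_add_le_exp_mul (h : RenewalWeights d p c C) {L : ℕ} (hL : 1 ≤ L) (m : ℕ) :
    ∑ j ∈ range (L + m), p j ≤ Real.exp (C * (m / L)) * ∑ j ∈ range L, p j := by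
  have hL' : (0 : ℝ) < L := by exact_mod_cast hL
  induction m with
  | zero => simp
  | succ m ih =>
    have hterm : p (L + m) ≤ C / L * ∑ j ∈ range (L + m), p j := by
      rw [div_mul_eq_mul_div, le_div_iff₀' hL']
      refine le_trans ?_ (h.mul_le_upper_mul_partialSum (L + m))
      gcongr
      · exact (h.pos _).le
      · exact Nat.le_add_right L m
    calc ∑ j ∈ range (L + m + 1), p j
        ≤ (1 + C / L) * ∑ j ∈ range (L + m), p j := by rw [sum_range_succ]; linarith
      _ ≤ Real.exp (C / L) * (Real.exp (C * (m / L)) * ∑ j ∈ range L, p j) := by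
          gcongr
          · exact (h.partialSum_pos (by lia)).le
          · linarith [Real.add_one_le_exp (C / L)]
      _ = Real.exp (C * ((m + 1 : ℕ) / L)) * ∑ j ∈ range L, p j := by
          rw [← mul_assoc, ← Real.exp_add]
          push_cast
          ring_nf

theorem partialSum_le_exp_mul (h : RenewalWeights d p c C) {L n K : ℕ} (hL : 1 ≤ L)
    (hn : n ≤ L * K) :
    ∑ j ∈ range n, p j ≤ Real.exp (C * K) * ∑ j ∈ range L, p j := by
  have hL' : (L : ℝ) ≠ 0 := by exact_mod_cast (show L ≠ 0 by lia)
  calc ∑ j ∈ range n, p j ≤ ∑ j ∈ range (L + L * K), p j := h.partialSum_mono (by lia)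
    _ ≤ Real.exp (C * ((L * K : ℕ) / L)) * ∑ j ∈ range L, p j := h.partialSum_add_le_exp_mul hL _
    _ = Real.exp (C * K) * ∑ j ∈ range L, p j := by rw [Nat.cast_mul, mul_div_cancel_left₀ _ hL']

theorem mul_le_exp_mul_sum (h : RenewalWeights d p c C) {L n K : ℕ} (hL : 1 ≤ L) (hLn : L ≤ n)
    (hn : n ≤ L * K) :
    n * p n ≤ C / c * Real.exp (C * K) * ∑ j ∈ range L, d (n - j) * p j := by
  have hc := h.lower_pos
  have hC := h.upper_pos
  calc n * p n ≤ C * ∑ j ∈ range n, p j := h.mul_le_upper_mul_partialSum n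
    _ ≤ C * (Real.exp (C * K) * ∑ j ∈ range L, p j) := by
        gcongr; exact h.partialSum_le_exp_mul hL hn
    _ = C / c * Real.exp (C * K) * (c * ∑ j ∈ range L, p j) := by field_simp
    _ ≤ C / c * Real.exp (C * K) * ∑ j ∈ range L, d (n - j) * p j := by
        gcongr; exact h.lower_mul_partialSum_le hLn

end Weights

end RenewalWeights

section Mixing

variable {ι E : Type*} [NormedAddCommGroup E] [NormedSpace ℝ E]

-- Doeblin's minorization: `w - κ v` is a nonnegative measure of mass `1 - κ`, and it is at most
-- `κ⁻¹ v`, so the part of `f` above the level `D` may be averaged against `v`.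
theorem norm_sum_smul_sub_smul_sum_le {s : Finset ι} {v w : ι → ℝ} {κ : ℝ} (hκ : 0 < κ)
    (hv : ∀ i ∈ s, 0 ≤ v i) (hvw : ∀ i ∈ s, κ * v i ≤ w i) (hwv : ∀ i ∈ s, κ * w i ≤ v i)
    (hmass : ∑ i ∈ s, w i = ∑ i ∈ s, v i) (f : ι → E) (D : ℝ) :
    ‖∑ i ∈ s, w i • f i - κ • ∑ i ∈ s, v i • f i‖
      ≤ (1 - κ) * D * ∑ i ∈ s, v i + κ⁻¹ * ∑ i ∈ s, v i * max (‖f i‖ - D) 0 := by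
  have hterm : ∀ i ∈ s, ‖(w i - κ * v i) • f i‖
      ≤ D * (w i - κ * v i) + κ⁻¹ * (v i * max (‖f i‖ - D) 0) := by
    intro i hi
    have hvi : 0 ≤ κ * v i := mul_nonneg hκ.le (hv i hi)
    have hdiff : w i - κ * v i ≤ κ⁻¹ * v i := by
      rw [le_inv_mul_iff₀ hκ]
      nlinarith [hwv i hi]
    rw [norm_smul, Real.norm_of_nonneg (sub_nonneg.2 (hvw i hi))]
    calc (w i - κ * v i) * ‖f i‖
        ≤ (w i - κ * v i) * (D + max (‖f i‖ - D) 0) := by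
          gcongr
          · exact sub_nonneg.2 (hvw i hi)
          · linarith [le_max_left (‖f i‖ - D) 0]
      _ = D * (w i - κ * v i) + (w i - κ * v i) * max (‖f i‖ - D) 0 := by ring
      _ ≤ D * (w i - κ * v i) + κ⁻¹ * v i * max (‖f i‖ - D) 0 := by gcongr
      _ = D * (w i - κ * v i) + κ⁻¹ * (v i * max (‖f i‖ - D) 0) := by ring
  calc ‖∑ i ∈ s, w i • f i - κ • ∑ i ∈ s, v i • f i‖
      = ‖∑ i ∈ s, (w i - κ * v i) • f i‖ := by
        simp only [sub_smul, mul_smul, Finset.sum_sub_distrib, Finset.smul_sum]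
    _ ≤ ∑ i ∈ s, (D * (w i - κ * v i) + κ⁻¹ * (v i * max (‖f i‖ - D) 0)) :=
        norm_sum_le_of_le s hterm
    _ = (1 - κ) * D * ∑ i ∈ s, v i + κ⁻¹ * ∑ i ∈ s, v i * max (‖f i‖ - D) 0 := by
        rw [Finset.sum_add_distrib, ← Finset.mul_sum, ← Finset.mul_sum, Finset.sum_sub_distrib,
          ← Finset.mul_sum, hmass]
        ring

end Mixing

/-- The defect at `n` of the harmonicity of `u` for the Markov chain on `ℕ` that jumps from `n` to
`j < n` with probability `d_{n - j} p_j / (n p_n)`, multiplied by `n p_n`. -/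
def renewalDefect {E : Type*} [AddCommGroup E] [Module ℝ E] (d p : ℕ → ℝ) (u : ℕ → E)
    (n : ℕ) : E :=
  (n * p n) • u n - ∑ j ∈ Finset.range n, (d (n - j) * p j) • u j

/-- The point at fraction `κ` of the way from `m` to the `p`-weighted mean of
`u 0, …, u (L - 1)`. -/
noncomputable def recenter {E : Type*} [AddCommGroup E] [Module ℝ E] (p : ℕ → ℝ) (u : ℕ → E)
    (κ : ℝ) (L : ℕ) (m : E) : E :=
  m + (κ / ∑ j ∈ Finset.range L, p j) • ∑ j ∈ Finset.range L, p j • (u j - m)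

/-- The deviation of `u 0, …, u (L - 1)` from `m` is at most `X`, where deviation is measured by
interpolating between the supremum norm and `2 / κ` times the `p`-weighted mean norm: the
distances are at most some level `D`, up to excesses whose weighted mean is accounted for.
The mean part keeps the old blocks, which have small weight, from obstructing the contraction. -/
def DeviationLE {E : Type*} [NormedAddCommGroup E] (p : ℕ → ℝ) (u : ℕ → E) (κ : ℝ) (L : ℕ) (m : E)
    (X : ℝ) : Prop :=
  ∃ D : ℝ, D * ∑ j ∈ Finset.range L, p j
    + 2 / κ * ∑ j ∈ Finset.range L, p j * max (‖u j - m‖ - D) 0 ≤ X * ∑ j ∈ Finset.range L, p j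

namespace RenewalWeights

open Finset

section Contraction

variable {E : Type*} [NormedAddCommGroup E] [NormedSpace ℝ E]
  {d p : ℕ → ℝ} {c C κ ε X Y : ℝ} {u : ℕ → E} {m : E} {L N : ℕ}

theorem renewalDefect_eq_sub_const (h : RenewalWeights d p c C) (u : ℕ → E) (m : E) (n : ℕ) :
    renewalDefect d p u n
      = (n * p n) • (u n - m) - ∑ j ∈ range n, (d (n - j) * p j) • (u j - m) := by
  simp only [renewalDefect, smul_sub, sum_sub_distrib, ← sum_smul, ← h.recursion]
  abel

-- Maximum principle: the chain started in `[L, N]` is followed until it drops below `L`, and each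
-- jump drops below `L` with probability at least `1 / T`.
theorem norm_sub_le_of_renewalDefect_le (h : RenewalWeights d p c C) {β T : ℝ}
    (hT : ∀ n ∈ Set.Icc L N, n * p n ≤ T * ∑ j ∈ range L, d (n - j) * p j)
    (hdefect : ∀ n ∈ Set.Icc L N, ‖renewalDefect d p u n‖ ≤ ε * (n * p n))
    (hβ : ∀ n ∈ Set.Icc L N, ‖∑ j ∈ range L, (d (n - j) * p j) • (u j - m)‖
      ≤ β * ∑ j ∈ range L, d (n - j) * p j) (hL : 1 ≤ L) (hε : 0 ≤ ε) :
    ∀ n ∈ Set.Icc L N, ‖u n - m‖ ≤ β + T * ε := by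
  intro n
  induction n using Nat.strong_induction_on with
  | _ n ih =>
    intro hn
    set W := ∑ j ∈ range L, d (n - j) * p j
    have hnp : 0 < n * p n := mul_pos (by exact_mod_cast hL.trans hn.1) (h.pos n)
    have hsplit : (n : ℝ) * p n = W + ∑ j ∈ Ico L n, d (n - j) * p j := by
      rw [h.recursion, sum_range_add_sum_Ico _ hn.1]
    have hnew : ‖∑ j ∈ Ico L n, (d (n - j) * p j) • (u j - m)‖
        ≤ (∑ j ∈ Ico L n, d (n - j) * p j) * (β + T * ε) := by
      rw [sum_mul]
      refine norm_sum_le_of_le _ fun j hj => ?_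
      obtain ⟨hLj, hjn⟩ := mem_Ico.1 hj
      rw [norm_smul, Real.norm_of_nonneg (h.coeff_mul_pos hjn).le]
      exact mul_le_mul_of_nonneg_left (ih j hjn ⟨hLj, hjn.le.trans hn.2⟩)
        (h.coeff_mul_pos hjn).le
    have hrec : (n * p n) • (u n - m) = renewalDefect d p u n
        + (∑ j ∈ range L, (d (n - j) * p j) • (u j - m)
          + ∑ j ∈ Ico L n, (d (n - j) * p j) • (u j - m)) := by
      rw [sum_range_add_sum_Ico _ hn.1, h.renewalDefect_eq_sub_const u m, sub_add_cancel]
    refine le_of_mul_le_mul_left ?_ hnp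
    calc (n * p n) * ‖u n - m‖ = ‖(n * p n) • (u n - m)‖ := by
          rw [norm_smul, Real.norm_of_nonneg hnp.le]
      _ ≤ ε * (n * p n) + (β * W + (∑ j ∈ Ico L n, d (n - j) * p j) * (β + T * ε)) := by
          rw [hrec]
          exact norm_add_le_of_le (hdefect n hn) (norm_add_le_of_le (hβ n hn) hnew)
      _ = (n * p n) * (β + T * ε) + ε * (n * p n - T * W) := by rw [hsplit]; ring
      _ ≤ (n * p n) * (β + T * ε) :=
          add_le_of_nonpos_right (mul_nonpos_of_nonneg_of_nonpos hε (sub_nonpos.2 (hT n hn)))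

end Contraction

end RenewalWeights

namespace DeviationLE

open Finset

variable {E : Type*} [NormedAddCommGroup E] {p : ℕ → ℝ} {u : ℕ → E} {κ X Y : ℝ} {L : ℕ} {m : E}

theorem exists_deviationLE (hS : 0 < ∑ j ∈ range L, p j) (u : ℕ → E) (κ : ℝ) (m : E) :
    ∃ X, DeviationLE p u κ L m X :=
  ⟨2 / κ * (∑ j ∈ range L, p j * max (‖u j - m‖ - 0) 0) / ∑ j ∈ range L, p j, 0, by
    rw [zero_mul, zero_add, div_mul_cancel₀ _ hS.ne']⟩

theorem mono (hX : DeviationLE p u κ L m X) (hS : 0 ≤ ∑ j ∈ range L, p j) (hXY : X ≤ Y) :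
    DeviationLE p u κ L m Y :=
  hX.imp fun _ hD => hD.trans (mul_le_mul_of_nonneg_right hXY hS)

theorem sum_le (hX : DeviationLE p u κ L m X) (hp : ∀ j, 0 ≤ p j) (hκ : 0 < κ) (hκ2 : κ ≤ 2) :
    ∑ j ∈ range L, p j * ‖u j - m‖ ≤ X * ∑ j ∈ range L, p j := by
  obtain ⟨D, hD⟩ := hX
  have hE : 0 ≤ ∑ j ∈ range L, p j * max (‖u j - m‖ - D) 0 :=
    sum_nonneg fun j _ => mul_nonneg (hp j) (le_max_right _ _)
  calc ∑ j ∈ range L, p j * ‖u j - m‖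
      ≤ ∑ j ∈ range L, (D * p j + p j * max (‖u j - m‖ - D) 0) := sum_le_sum fun j _ => by
        linarith [mul_le_mul_of_nonneg_left (le_max_left (‖u j - m‖ - D) 0) (hp j)]
    _ = D * ∑ j ∈ range L, p j + 1 * ∑ j ∈ range L, p j * max (‖u j - m‖ - D) 0 := by
        rw [sum_add_distrib, mul_sum, one_mul]
    _ ≤ D * ∑ j ∈ range L, p j + 2 / κ * ∑ j ∈ range L, p j * max (‖u j - m‖ - D) 0 := by
        gcongr
        exact (one_le_div hκ).2 hκ2
    _ ≤ X * ∑ j ∈ range L, p j := hD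

theorem nonneg (hX : DeviationLE p u κ L m X) (hp : ∀ j, 0 ≤ p j) (hS : 0 < ∑ j ∈ range L, p j)
    (hκ : 0 < κ) (hκ2 : κ ≤ 2) : 0 ≤ X :=
  nonneg_of_mul_nonneg_left ((sum_nonneg fun j _ => mul_nonneg (hp j) (norm_nonneg _)).trans
    (hX.sum_le hp hκ hκ2)) hS

theorem norm_recenter_sub_le [NormedSpace ℝ E] (hX : DeviationLE p u κ L m X)
    (hp : ∀ j, 0 ≤ p j) (hS : 0 < ∑ j ∈ range L, p j) (hκ : 0 < κ) (hκ2 : κ ≤ 2) :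
    ‖recenter p u κ L m - m‖ ≤ κ * X := by
  rw [recenter, add_sub_cancel_left, norm_smul, Real.norm_of_nonneg (by positivity),
    div_mul_eq_mul_div, div_le_iff₀ hS, mul_assoc]
  refine mul_le_mul_of_nonneg_left (le_trans (norm_sum_le_of_le _ fun j _ => ?_)
    (hX.sum_le hp hκ hκ2)) hκ.le
  rw [norm_smul, Real.norm_of_nonneg (hp j)]

end DeviationLE

theorem sum_smul_sub_recenter {E : Type*} [AddCommGroup E] [Module ℝ E] (p w : ℕ → ℝ)
    (u : ℕ → E) (κ : ℝ) (L : ℕ) (m : E) :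
    ∑ j ∈ Finset.range L, w j • (u j - recenter p u κ L m)
      = ∑ j ∈ Finset.range L, w j • (u j - m) - κ • ∑ j ∈ Finset.range L,
        ((∑ i ∈ Finset.range L, w i) / (∑ i ∈ Finset.range L, p i) * p j) • (u j - m) := by
  set r := (∑ i ∈ Finset.range L, w i) / ∑ i ∈ Finset.range L, p i with hr
  simp only [recenter, ← sub_sub, smul_sub (_ : ℝ) (u _ - m), Finset.sum_sub_distrib,
    ← Finset.sum_smul, mul_smul r, ← Finset.smul_sum]
  rw [smul_smul, smul_smul, hr, mul_div_left_comm]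

namespace RenewalWeights

open Finset

section Contraction

variable {E : Type*} [NormedAddCommGroup E] [NormedSpace ℝ E]
  {d p : ℕ → ℝ} {c C κ ε X Y : ℝ} {u : ℕ → E} {m : E} {K L n : ℕ}

theorem norm_sum_smul_sub_recenter_le (h : RenewalWeights d p c C)
    (hX : DeviationLE p u κ L m X) (hκ : 0 < κ) (hκ2 : κ ≤ 1 / 2) (hκC : κ * C ≤ c)
    (hL : 1 ≤ L) (hLn : L ≤ n) :
    ‖∑ j ∈ range L, (d (n - j) * p j) • (u j - recenter p u κ L m)‖
      ≤ (1 - κ) * X * ∑ j ∈ range L, d (n - j) * p j := by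
  obtain ⟨D, hD⟩ := hX
  have hS := h.partialSum_pos hL
  set S := ∑ j ∈ range L, p j
  set W := ∑ j ∈ range L, d (n - j) * p j
  set r := W / S
  have hrS : r * S = W := div_mul_cancel₀ _ hS.ne'
  have hcr : c ≤ r := (le_div_iff₀ hS).2 (h.lower_mul_partialSum_le hLn)
  have hrC : r ≤ C := (div_le_iff₀ hS).2 (h.le_upper_mul_partialSum hLn)
  have hr : 0 < r := h.lower_pos.trans_le hcr
  have hvw : ∀ j ∈ range L, κ * (r * p j) ≤ d (n - j) * p j := fun j hj => by
    rw [← mul_assoc]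
    exact mul_le_mul_of_nonneg_right (((mul_le_mul_of_nonneg_left hrC hκ.le).trans hκC).trans
      (h.lower_le_coeff ((mem_range.1 hj).trans_le hLn))) (h.pos j).le
  have hwv : ∀ j ∈ range L, κ * (d (n - j) * p j) ≤ r * p j := fun j hj => by
    rw [← mul_assoc]
    exact mul_le_mul_of_nonneg_right (((mul_le_mul_of_nonneg_left
      (h.coeff_le_upper ((mem_range.1 hj).trans_le hLn)) hκ.le).trans hκC).trans hcr) (h.pos j).le
  rw [sum_smul_sub_recenter]
  refine (norm_sum_smul_sub_smul_sum_le hκ (fun j _ => mul_nonneg hr.le (h.pos j).le) hvw hwv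
    (by rw [← mul_sum, hrS]) _ D).trans ?_
  simp only [mul_assoc r, ← mul_sum]
  calc (1 - κ) * D * (r * S) + κ⁻¹ * (r * ∑ j ∈ range L, p j * max (‖u j - m‖ - D) 0)
      = r * ((1 - κ) * (D * S)
        + κ⁻¹ * ∑ j ∈ range L, p j * max (‖u j - m‖ - D) 0) := by ring
    _ ≤ r * ((1 - κ) * (D * S)
        + (1 - κ) * (2 / κ) * ∑ j ∈ range L, p j * max (‖u j - m‖ - D) 0) := by
        gcongr
        · exact sum_nonneg fun j _ => mul_nonneg (h.pos j).le (le_max_right _ _)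
        · rw [inv_eq_one_div, ← mul_div_assoc]
          gcongr
          linarith
    _ = r * ((1 - κ) * (D * S
        + 2 / κ * ∑ j ∈ range L, p j * max (‖u j - m‖ - D) 0)) := by ring
    _ ≤ r * ((1 - κ) * (X * S)) := by
        gcongr
        linarith
    _ = (1 - κ) * X * W := by rw [← hrS]; ring

theorem norm_sub_recenter_le (h : RenewalWeights d p c C) (hX : DeviationLE p u κ L m X)
    (hκ : 0 < κ) (hκ2 : κ ≤ 1 / 2) (hκC : κ * C ≤ c) (hL : 1 ≤ L) (hε : 0 ≤ ε)
    (hdefect : ∀ n, L ≤ n → ‖renewalDefect d p u n‖ ≤ ε * (n * p n)) :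
    ∀ n ∈ Set.Icc L (L * K),
      ‖u n - recenter p u κ L m‖ ≤ (1 - κ) * X + C / c * Real.exp (C * K) * ε :=
  h.norm_sub_le_of_renewalDefect_le (fun _ hn => h.mul_le_exp_mul_sum hL hn.1 hn.2)
    (fun n hn => hdefect n hn.1)
    (fun _ hn => h.norm_sum_smul_sub_recenter_le hX hκ hκ2 hκC hL hn.1) hL hε

theorem sum_norm_sub_recenter_le (h : RenewalWeights d p c C) (hX : DeviationLE p u κ L m X)
    (hκ : 0 < κ) (hκ1 : κ ≤ 1) (hL : 1 ≤ L) :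
    ∑ j ∈ range L, p j * ‖u j - recenter p u κ L m‖ ≤ 2 * X * ∑ j ∈ range L, p j := by
  have hp : ∀ j, 0 ≤ p j := fun j => (h.pos j).le
  have hS := h.partialSum_pos hL
  have hX0 : 0 ≤ X := hX.nonneg hp hS hκ (by linarith)
  have hmove := hX.norm_recenter_sub_le hp hS hκ (by linarith)
  calc ∑ j ∈ range L, p j * ‖u j - recenter p u κ L m‖
      ≤ ∑ j ∈ range L, (p j * ‖u j - m‖ + κ * X * p j) := sum_le_sum fun j _ => by
        rw [mul_comm (κ * X), ← mul_add]
        refine mul_le_mul_of_nonneg_left ?_ (hp j)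
        rw [norm_sub_rev] at hmove
        exact norm_sub_le_norm_sub_add_norm_sub (u j) m _ |>.trans (by linarith)
    _ = ∑ j ∈ range L, p j * ‖u j - m‖ + κ * X * ∑ j ∈ range L, p j := by
        rw [sum_add_distrib, mul_sum]
    _ ≤ X * ∑ j ∈ range L, p j + 1 * X * ∑ j ∈ range L, p j := by
        gcongr
        exact hX.sum_le hp hκ (by linarith)
    _ = 2 * X * ∑ j ∈ range L, p j := by ring

theorem deviationLE_recenter (h : RenewalWeights d p c C) (hX : DeviationLE p u κ L m X)
    (hκ : 0 < κ) (hκ1 : κ ≤ 1) (hL : 1 ≤ L) (hK : 1 ≤ K)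
    (hscale : ∑ j ∈ range L, p j ≤ κ ^ 2 / 8 * ∑ j ∈ range (L * K), p j)
    (hY : 0 ≤ Y) (hnew : ∀ n ∈ Set.Icc L (L * K), ‖u n - recenter p u κ L m‖ ≤ Y) :
    DeviationLE p u κ (L * K) (recenter p u κ L m) (Y + κ / 2 * X) := by
  set m' := recenter p u κ L m
  have hX0 : 0 ≤ X := hX.nonneg (fun j => (h.pos j).le) (h.partialSum_pos hL) hκ (by linarith)
  have hnew0 : ∑ j ∈ Ico L (L * K), p j * max (‖u j - m'‖ - Y) 0 = 0 := by
    refine sum_eq_zero fun j hj => ?_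
    obtain ⟨hLj, hjK⟩ := mem_Ico.1 hj
    rw [max_eq_right (sub_nonpos.2 (hnew j ⟨hLj, hjK.le⟩)), mul_zero]
  have hold : ∑ j ∈ range L, p j * max (‖u j - m'‖ - Y) 0 ≤ 2 * X * ∑ j ∈ range L, p j :=
    (sum_le_sum fun j _ => mul_le_mul_of_nonneg_left
      (max_le (sub_le_self _ hY) (norm_nonneg _)) (h.pos j).le).trans
      (h.sum_norm_sub_recenter_le hX hκ hκ1 hL)
  refine ⟨Y, ?_⟩
  rw [← sum_range_add_sum_Ico (fun j => p j * max (‖u j - m'‖ - Y) 0)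
    (Nat.le_mul_of_pos_right L hK), hnew0, add_zero, add_mul]
  refine add_le_add le_rfl ?_
  calc 2 / κ * ∑ j ∈ range L, p j * max (‖u j - m'‖ - Y) 0
      ≤ 2 / κ * (2 * X * (κ ^ 2 / 8 * ∑ j ∈ range (L * K), p j)) := by
        gcongr
        exact hold.trans (mul_le_mul_of_nonneg_left hscale (by positivity))
    _ = κ / 2 * X * ∑ j ∈ range (L * K), p j := by
        field_simp
        ring

end Contraction

end RenewalWeights

/-- The centers of the successive blocks `[0, K ^ i)`, each obtained by recentering the previous one
on the block just completed. -/
noncomputable def blockCenter {E : Type*} [AddCommGroup E] [Module ℝ E] (p : ℕ → ℝ) (u : ℕ → E)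
    (κ : ℝ) (K : ℕ) : ℕ → E
  | 0 => u 0
  | i + 1 => recenter p u κ (K ^ i) (blockCenter p u κ K i)

section BlockGrowth

variable {E : Type*} [NormedAddCommGroup E] {u m : ℕ → E} {K i : ℕ} {ε : ℝ}

theorem norm_center_sub_center_le (hK : 1 ≤ K)
    (hm : ∀ r, i ≤ r → ∀ n ∈ Set.Icc (K ^ r) (K ^ (r + 1)), ‖u n - m r‖ ≤ ε) (s : ℕ) :
    ‖m (i + s) - m i‖ ≤ 2 * s * ε := by
  have hpow : ∀ r, K ^ r ≤ K ^ (r + 1) := fun r => Nat.pow_le_pow_right hK r.le_succ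
  induction s with
  | zero => simp
  | succ s ih =>
    have hold := hm (i + s) (by lia) _ (Set.right_mem_Icc.2 (hpow _))
    have hnew := hm (i + s + 1) (by lia) _ (Set.left_mem_Icc.2 (hpow _))
    have hstep := norm_sub_le_norm_sub_add_norm_sub (m (i + s + 1)) (u (K ^ (i + s + 1)))
      (m (i + s))
    rw [norm_sub_rev] at hnew
    calc ‖m (i + (s + 1)) - m i‖ ≤ ‖m (i + s + 1) - m (i + s)‖ + ‖m (i + s) - m i‖ :=
          norm_sub_le_norm_sub_add_norm_sub _ _ _
      _ ≤ (ε + ε) + 2 * s * ε := add_le_add (by linarith) ih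
      _ = 2 * ((s + 1 : ℕ) : ℝ) * ε := by push_cast; ring

-- The distance grows only logarithmically in `n`; the linear bound is all that is needed.
theorem norm_sub_center_le_two_mul_div (hK : 2 ≤ K) (hε : 0 ≤ ε)
    (hm : ∀ r, i ≤ r → ∀ n ∈ Set.Icc (K ^ r) (K ^ (r + 1)), ‖u n - m r‖ ≤ ε) {n : ℕ}
    (hn : K ^ i ≤ n) : ‖u n - m i‖ ≤ 2 * ε * (n / K ^ i) := by
  have hn0 : n ≠ 0 := ((Nat.pow_pos (by lia)).trans_le hn).ne'
  obtain ⟨s, hs⟩ := Nat.exists_eq_add_of_le (Nat.le_log_of_pow_le hK hn)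
  have hlow : K ^ (i + s) ≤ n := hs ▸ Nat.pow_log_le_self K hn0
  have hhigh : n ≤ K ^ (i + s + 1) := (hs ▸ Nat.lt_pow_succ_log_self hK n).le
  have : (0 : ℝ) < K := by exact_mod_cast (show 0 < K by lia)
  have hs_le : ((s + 1 : ℕ) : ℝ) ≤ n / K ^ i := by
    rw [le_div_iff₀ (by positivity)]
    calc ((s + 1 : ℕ) : ℝ) * K ^ i ≤ (K ^ s : ℕ) * K ^ i := by
          gcongr
          exact Nat.lt_pow_self (by lia)
      _ = (K ^ (i + s) : ℕ) := by push_cast; ring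
      _ ≤ n := by exact_mod_cast hlow
  calc ‖u n - m i‖ ≤ ‖u n - m (i + s)‖ + ‖m (i + s) - m i‖ :=
        norm_sub_le_norm_sub_add_norm_sub _ _ _
    _ ≤ ε + 2 * s * ε := add_le_add (hm _ (by lia) n ⟨hlow, hhigh⟩)
        (norm_center_sub_center_le (by lia) hm s)
    _ ≤ 2 * ε * ((s + 1 : ℕ) : ℝ) := by push_cast; linarith
    _ ≤ 2 * ε * (n / K ^ i) := by gcongr

end BlockGrowth

/-- A contraction rate `κ` and a block ratio `K` for which passing from the block `[0, L)` to the
block `[0, L K)` contracts deviations by the factor `1 - κ / 2`. -/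
structure ContractionScale (p : ℕ → ℝ) (c C κ : ℝ) (K : ℕ) : Prop where
  rate_pos : 0 < κ
  rate_le_half : κ ≤ 1 / 2
  rate_mul_le : κ * C ≤ c
  two_le : 2 ≤ K
  partialSum_le : ∀ L : ℕ, 1 ≤ L →
    ∑ j ∈ Finset.range L, p j ≤ κ ^ 2 / 8 * ∑ j ∈ Finset.range (L * K), p j

namespace RenewalWeights

open Finset

section Blocks

variable {E : Type*} [NormedAddCommGroup E] [NormedSpace ℝ E]
  {d p : ℕ → ℝ} {c C κ ε X : ℝ} {u : ℕ → E} {K i : ℕ}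

theorem exists_contractionScale (h : RenewalWeights d p c C) :
    ∃ (κ : ℝ) (K : ℕ), ContractionScale p c C κ K := by
  have hc := h.lower_pos
  have hC := h.upper_pos
  obtain ⟨K, hK, hscale⟩ := h.exists_partialSum_le_mul (q := (c / (2 * C)) ^ 2 / 8) (by positivity)
  refine ⟨c / (2 * C), K, by positivity, ?_, ?_, hK, hscale⟩
  · rw [div_le_iff₀ (by positivity)]
    linarith [h.lower_le_upper]
  · rw [div_mul_eq_mul_div, div_le_iff₀ (by positivity)]
    nlinarith

theorem deviationLE_blockCenter_succ (h : RenewalWeights d p c C)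
    (hs : ContractionScale p c C κ K)
    (hX : DeviationLE p u κ (K ^ i) (blockCenter p u κ K i) X) (hε : 0 ≤ ε)
    (hdefect : ∀ n, K ^ i ≤ n → ‖renewalDefect d p u n‖ ≤ ε * (n * p n)) :
    DeviationLE p u κ (K ^ (i + 1)) (blockCenter p u κ K (i + 1))
      ((1 - κ / 2) * X + C / c * Real.exp (C * K) * ε) := by
  have hc := h.lower_pos
  have hC := h.upper_pos
  have hκ := hs.rate_pos
  have hκ2 := hs.rate_le_half
  have hK : 1 ≤ K := by have := hs.two_le; lia
  have hL : 1 ≤ K ^ i := Nat.one_le_pow _ _ hK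
  have hX0 := hX.nonneg (fun j => (h.pos j).le) (h.partialSum_pos hL) hκ (by linarith)
  have hκ1 : 0 ≤ 1 - κ := by linarith
  have hstep := h.deviationLE_recenter hX hκ (by linarith) hL hK (hs.partialSum_le _ hL)
    (by positivity) (h.norm_sub_recenter_le hX hκ hκ2 hs.rate_mul_le hL hε hdefect)
  rw [← pow_succ] at hstep
  rwa [show (1 - κ / 2) * X + C / c * Real.exp (C * K) * ε
    = (1 - κ) * X + C / c * Real.exp (C * K) * ε + κ / 2 * X by ring]

theorem deviationLE_blockCenter_add (h : RenewalWeights d p c C)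
    (hs : ContractionScale p c C κ K)
    (hX : DeviationLE p u κ (K ^ i) (blockCenter p u κ K i) X) (hε : 0 ≤ ε)
    (hdefect : ∀ n, K ^ i ≤ n → ‖renewalDefect d p u n‖ ≤ ε * (n * p n)) (k : ℕ) :
    DeviationLE p u κ (K ^ (i + k)) (blockCenter p u κ K (i + k))
      ((1 - κ / 2) ^ k * X + 2 / κ * (C / c * Real.exp (C * K) * ε)) := by
  have hc := h.lower_pos
  have hC := h.upper_pos
  have hκ := hs.rate_pos
  have hK : 1 ≤ K := by have := hs.two_le; lia
  induction k with
  | zero =>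
    refine hX.mono (h.partialSum_pos (Nat.one_le_pow _ _ hK)).le ?_
    rw [pow_zero, one_mul]
    exact le_add_of_nonneg_right (by positivity)
  | succ k ih =>
    have hpow : K ^ i ≤ K ^ (i + k) := Nat.pow_le_pow_right hK (Nat.le_add_right i k)
    have hsucc := h.deviationLE_blockCenter_succ hs ih hε fun n hn => hdefect n (hpow.trans hn)
    refine hsucc.mono (h.partialSum_pos (Nat.one_le_pow _ _ hK)).le (le_of_eq ?_)
    rw [pow_succ]
    field_simp
    ring

theorem eventually_norm_renewalDefect_le (h : RenewalWeights d p c C) (hK : 2 ≤ K)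
    (hdefect : renewalDefect d p u =o[atTop] fun n => n * p n) (hε : 0 < ε) :
    ∀ᶠ i in atTop, ∀ n, K ^ i ≤ n → ‖renewalDefect d p u n‖ ≤ ε * (n * p n) := by
  have hnorm : ∀ᶠ n in atTop, ‖renewalDefect d p u n‖ ≤ ε * (n * p n) := by
    filter_upwards [hdefect.def hε] with n hn
    rwa [Real.norm_of_nonneg (mul_nonneg n.cast_nonneg (h.pos n).le)] at hn
  exact (tendsto_pow_atTop_atTop_of_one_lt hK).eventually (eventually_forall_ge_atTop.2 hnorm)

theorem eventually_deviationLE_blockCenter (h : RenewalWeights d p c C)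
    (hs : ContractionScale p c C κ K)
    (hdefect : renewalDefect d p u =o[atTop] fun n => n * p n) (hε : 0 < ε) :
    ∀ᶠ i in atTop, DeviationLE p u κ (K ^ i) (blockCenter p u κ K i) ε := by
  have hc := h.lower_pos
  have hC := h.upper_pos
  have hκ := hs.rate_pos
  have hκ2 := hs.rate_le_half
  have hS : ∀ i, 0 < ∑ j ∈ range (K ^ i), p j := fun i =>
    h.partialSum_pos (Nat.one_le_pow _ _ (by have := hs.two_le; lia))
  set T := C / c * Real.exp (C * K) with hT
  have hT0 : 0 < T := by positivity
  obtain ⟨i₀, hi₀⟩ := (h.eventually_norm_renewalDefect_le hs.two_le hdefect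
    (show 0 < κ * ε / (4 * T) by positivity)).exists
  obtain ⟨X, hX⟩ := DeviationLE.exists_deviationLE (hS i₀) u κ (blockCenter p u κ K i₀)
  have hlim : Tendsto (fun k : ℕ => (1 - κ / 2) ^ k * X + ε / 2) atTop (𝓝 (0 * X + ε / 2)) :=
    ((tendsto_pow_atTop_nhds_zero_of_lt_one (by linarith) (by linarith)).mul_const X).add_const _
  rw [← map_add_atTop_eq_nat i₀, eventually_map]
  filter_upwards [hlim.eventually_le_const (show 0 * X + ε / 2 < ε by linarith)] with k hk
  rw [add_comm k]
  refine (h.deviationLE_blockCenter_add hs hX (by positivity) hi₀ k).mono (hS _).le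
    (le_of_eq_of_le ?_ hk)
  rw [← hT]
  field_simp
  ring

theorem eventually_forall_norm_sub_blockCenter_le (h : RenewalWeights d p c C)
    (hs : ContractionScale p c C κ K)
    (hdefect : renewalDefect d p u =o[atTop] fun n => n * p n) (hε : 0 < ε) :
    ∀ᶠ i in atTop, ∀ n ∈ Set.Icc (K ^ i) (K ^ (i + 1)), ‖u n - blockCenter p u κ K i‖ ≤ ε := by
  have hc := h.lower_pos
  have hC := h.upper_pos
  have hκ := hs.rate_pos
  have hκ2 := hs.rate_le_half
  set T := C / c * Real.exp (C * K)
  have hT0 : 0 < T := by positivity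
  filter_upwards [h.eventually_deviationLE_blockCenter hs hdefect (half_pos hε),
    h.eventually_norm_renewalDefect_le hs.two_le hdefect (show 0 < ε / (2 * T) by positivity)]
    with i hX hi n hn
  have hL : 1 ≤ K ^ i := Nat.one_le_pow _ _ (by have := hs.two_le; lia)
  have hnew := h.norm_sub_recenter_le hX hκ hκ2 hs.rate_mul_le hL (by positivity) hi n
    (by rwa [← pow_succ])
  have hmove := hX.norm_recenter_sub_le (fun j => (h.pos j).le) (h.partialSum_pos hL) hκ
    (by linarith)
  calc ‖u n - blockCenter p u κ K i‖
      ≤ ((1 - κ) * (ε / 2) + T * (ε / (2 * T))) + κ * (ε / 2) :=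
        (norm_sub_le_norm_sub_add_norm_sub _ _ _).trans (add_le_add hnew hmove)
    _ = ε := by
        field_simp
        ring

theorem exists_centers (h : RenewalWeights d p c C)
    (hdefect : renewalDefect d p u =o[atTop] fun n => n * p n) :
    ∃ (K : ℕ) (m : ℕ → E), 2 ≤ K ∧ ∀ ε > 0, ∀ᶠ i in atTop,
      ∑ j ∈ range (K ^ i), p j * ‖u j - m i‖ ≤ ε * ∑ j ∈ range (K ^ i), p j ∧
        ∀ n, K ^ i ≤ n → ‖u n - m i‖ ≤ ε * (n / K ^ i) := by
  obtain ⟨κ, K, hs⟩ := h.exists_contractionScale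
  have hκ2 := hs.rate_le_half
  refine ⟨K, blockCenter p u κ K, hs.two_le, fun ε hε => ?_⟩
  filter_upwards [h.eventually_deviationLE_blockCenter hs hdefect hε, eventually_forall_ge_atTop.2
    (h.eventually_forall_norm_sub_blockCenter_le hs hdefect (half_pos hε))] with i hX hi
  refine ⟨hX.sum_le (fun j => (h.pos j).le) hs.rate_pos (by linarith), fun n hn => ?_⟩
  have hgrowth := norm_sub_center_le_two_mul_div hs.two_le (half_pos hε).le hi hn
  rwa [mul_div_cancel₀ _ two_ne_zero] at hgrowth

end Blocks

section GeneratingFunction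

variable {d p : ℕ → ℝ} {c C : ℝ}

theorem pow_mul_partialSum_le_of_hasSum (h : RenewalWeights d p c C) {x s : ℝ} (hx0 : 0 ≤ x)
    (hx1 : x ≤ 1) (hs : HasSum (fun j => p j * x ^ j) s) (n : ℕ) :
    x ^ n * ∑ j ∈ range n, p j ≤ s := by
  refine le_trans ?_ (sum_le_hasSum (range n)
    (fun j _ => mul_nonneg (h.pos j).le (pow_nonneg hx0 j)) hs)
  rw [mul_sum]
  refine sum_le_sum fun j hj => ?_
  rw [mul_comm]
  exact mul_le_mul_of_nonneg_left (pow_le_pow_of_le_one hx0 hx1 (mem_range.1 hj).le) (h.pos j).le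

theorem tendsto_genFun_atTop (h : RenewalWeights d p c C) {f : ℝ → ℝ}
    (hf : ∀ x, 0 ≤ x → x < 1 → HasSum (fun j => p j * x ^ j) (f x)) :
    Tendsto f (𝓝[<] 1) atTop := by
  refine tendsto_atTop.2 fun b => ?_
  obtain ⟨n, hn⟩ := (h.tendsto_partialSum_atTop.eventually_gt_atTop b).exists
  have hlim : Tendsto (fun x : ℝ => x ^ n * ∑ j ∈ range n, p j) (𝓝[<] 1)
      (𝓝 (1 ^ n * ∑ j ∈ range n, p j)) :=
    (Continuous.tendsto (by fun_prop) 1).mono_left nhdsWithin_le_nhds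
  rw [one_pow, one_mul] at hlim
  filter_upwards [hlim.eventually_const_le hn, Ioo_mem_nhdsLT one_pos] with x hx hx'
  exact hx.trans (h.pow_mul_partialSum_le_of_hasSum hx'.1.le hx'.2.le (hf x hx'.1.le hx'.2) n)

theorem mul_pow_mul_le_of_le_mul_div (h : RenewalWeights d p c C) {x y ε : ℝ} {j L : ℕ}
    (hx0 : 0 ≤ x) (hε : 0 ≤ ε) (hy : y ≤ ε * (j / L)) :
    p j * x ^ j * y ≤ ε / L * C * ((∑ k ∈ range (j + 1), p k) * x ^ j) := by
  have hmass : j * p j ≤ C * ∑ k ∈ range (j + 1), p k :=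
    (h.mul_le_upper_mul_partialSum j).trans
      (mul_le_mul_of_nonneg_left (h.partialSum_mono j.le_succ) h.upper_pos.le)
  calc p j * x ^ j * y ≤ p j * x ^ j * (ε * (j / L)) :=
        mul_le_mul_of_nonneg_left hy (mul_nonneg (h.pos j).le (pow_nonneg hx0 j))
    _ = ε / L * x ^ j * (j * p j) := by ring
    _ ≤ ε / L * x ^ j * (C * ∑ k ∈ range (j + 1), p k) := by gcongr
    _ = ε / L * C * ((∑ k ∈ range (j + 1), p k) * x ^ j) := by ring

end GeneratingFunction

section PowerMean

variable {E : Type*} [NormedAddCommGroup E] [NormedSpace ℝ E]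
  {d p : ℕ → ℝ} {c C ε : ℝ} {u : ℕ → E} {f : ℝ → ℝ} {g : ℝ → E} {A m : E} {L : ℕ}

theorem tendsto_powerMean (h : RenewalWeights d p c C)
    (hf : ∀ x, 0 ≤ x → x < 1 → HasSum (fun j => p j * x ^ j) (f x))
    (hg : ∀ x, 0 ≤ x → x < 1 → HasSum (fun j => (p j * x ^ j) • u j) (f x • g x))
    (hu : Tendsto u atTop (𝓝 A)) : Tendsto g (𝓝[<] 1) (𝓝 A) := by
  rw [tendsto_iff_norm_sub_tendsto_zero] at hu ⊢
  refine Metric.tendsto_nhds.2 fun ε hε => ?_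
  obtain ⟨N, hN⟩ := eventually_atTop.1 (hu.eventually_le_const (half_pos hε))
  set M := ∑ j ∈ range N, p j * ‖u j - A‖
  filter_upwards [(h.tendsto_genFun_atTop hf).eventually_gt_atTop (2 * M / ε),
    (h.tendsto_genFun_atTop hf).eventually_gt_atTop 0, Ioo_mem_nhdsLT one_pos]
    with x hfx hfx0 ⟨hx0, hx1⟩
  have hw : ∀ j, 0 ≤ p j * x ^ j := fun j => mul_nonneg (h.pos j).le (pow_nonneg hx0.le j)
  have hcomp := mul_norm_sub_le_of_hasSum hw (hf x hx0.le hx1) (hg x hx0.le hx1)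
    (fun j => mul_nonneg (half_pos hε).le (hw j)) ((hf x hx0.le hx1).mul_left (ε / 2))
    (N := N) (m := A) fun j hj => by
      rw [mul_comm]
      exact mul_le_mul_of_nonneg_right (hN j hj) (hw j)
  have hhead : ∑ j ∈ range N, p j * x ^ j * ‖u j - A‖ ≤ M := sum_le_sum fun j _ => by
    gcongr
    exact mul_le_of_le_one_right (h.pos j).le (pow_le_one₀ hx0.le hx1.le)
  rw [div_lt_iff₀ hε] at hfx
  rw [dist_zero_right, norm_norm]
  refine lt_of_mul_lt_mul_left ?_ hfx0.le
  linarith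

theorem isLittleO_renewalDefect (h : RenewalWeights d p c C) (hu : Tendsto u atTop (𝓝 A)) :
    renewalDefect d p u =o[atTop] fun n => n * p n := by
  have hdiff : (fun n => u n - A) =o[atTop] fun _ => (1 : ℝ) :=
    (isLittleO_one_iff ℝ).2 (tendsto_sub_nhds_zero_iff.2 hu)
  have hterm : (fun n => (n * p n) • (u n - A)) =o[atTop] fun n => n * p n := by
    simpa using (isBigO_refl (fun n : ℕ => n * p n) atTop).smul_isLittleO hdiff
  have hsum : (fun n => ∑ j ∈ range n, p j * ‖u j - A‖) =o[atTop] fun n => ∑ j ∈ range n, p j :=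
    IsLittleO.sum_range (by simpa using (isBigO_refl p atTop).mul_isLittleO hdiff.norm_left)
      (fun j => (h.pos j).le) h.tendsto_partialSum_atTop
  have havg : (fun n => ∑ j ∈ range n, (d (n - j) * p j) • (u j - A))
      =O[atTop] fun n => ∑ j ∈ range n, p j * ‖u j - A‖ := by
    refine IsBigO.of_bound C (.of_forall fun n => ?_)
    rw [Real.norm_of_nonneg (sum_nonneg fun j _ => mul_nonneg (h.pos j).le (norm_nonneg _)),
      mul_sum]
    refine norm_sum_le_of_le _ fun j hj => ?_
    have hjn := mem_range.1 hj
    rw [norm_smul, Real.norm_of_nonneg (h.coeff_mul_pos hjn).le, mul_assoc]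
    exact mul_le_mul_of_nonneg_right (h.coeff_le_upper hjn)
      (mul_nonneg (h.pos j).le (norm_nonneg _))
  have hmass : (fun n => ∑ j ∈ range n, p j) =O[atTop] fun n : ℕ => n * p n := by
    refine IsBigO.of_bound c⁻¹ (.of_forall fun n => ?_)
    rw [Real.norm_of_nonneg (sum_nonneg fun j _ => (h.pos j).le),
      Real.norm_of_nonneg (mul_nonneg n.cast_nonneg (h.pos n).le), le_inv_mul_iff₀ h.lower_pos]
    exact h.lower_mul_partialSum_le_mul n
  exact (hterm.sub ((havg.trans_isLittleO hsum).trans_isBigO hmass)).congr_left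
    fun n => (h.renewalDefect_eq_sub_const u A n).symm

theorem norm_sub_powerMean_le (h : RenewalWeights d p c C)
    (hf : ∀ x, 0 ≤ x → x < 1 → HasSum (fun j => p j * x ^ j) (f x))
    (hg : ∀ x, 0 ≤ x → x < 1 → HasSum (fun j => (p j * x ^ j) • u j) (f x • g x))
    (hL : 1 ≤ L) (hε : 0 ≤ ε)
    (hmean : ∑ j ∈ range L, p j * ‖u j - m‖ ≤ ε * ∑ j ∈ range L, p j)
    (hgrowth : ∀ j, L ≤ j → ‖u j - m‖ ≤ ε * (j / L)) :
    ‖g (1 - (2 * (L : ℝ))⁻¹) - m‖ ≤ (2 + 2 * C) * ε := by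
  have hC := h.upper_pos
  have : (0 : ℝ) < L := by exact_mod_cast hL
  obtain ⟨hx0, hx1, hxL⟩ := one_sub_inv_two_mul_bounds hL
  set x := 1 - (2 * (L : ℝ))⁻¹ with hx
  have hp : ∀ j, 0 ≤ p j := fun j => (h.pos j).le
  have hpx : ∀ j, 0 ≤ p j * x ^ j := fun j => mul_nonneg (hp j) (pow_nonneg hx0 j)
  have hS : ∑ j ∈ range L, p j ≤ 2 * f x := by
    have hpow := h.pow_mul_partialSum_le_of_hasSum hx0 hx1.le (hf x hx0 hx1) L
    nlinarith [h.partialSum_pos hL]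
  have hfx : 0 < f x := by linarith [h.partialSum_pos hL]
  have hhead : ∑ j ∈ range L, p j * x ^ j * ‖u j - m‖ ≤ ε * (2 * f x) :=
    calc ∑ j ∈ range L, p j * x ^ j * ‖u j - m‖ ≤ ∑ j ∈ range L, p j * ‖u j - m‖ :=
          sum_le_sum fun j _ => mul_le_mul_of_nonneg_right
            (mul_le_of_le_one_right (hp j) (pow_le_one₀ hx0 hx1.le)) (norm_nonneg _)
      _ ≤ ε * (2 * f x) := hmean.trans (mul_le_mul_of_nonneg_left hS hε)
  have hcomp := mul_norm_sub_le_of_hasSum hpx (hf x hx0 hx1) (hg x hx0 hx1)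
    (fun j => mul_nonneg (by positivity)
      (mul_nonneg (sum_nonneg fun k _ => hp k) (pow_nonneg hx0 j)))
    ((hasSum_partialSum_mul_pow hp hx0 hx1 (hf x hx0 hx1)).mul_left _)
    fun j hj => h.mul_pow_mul_le_of_le_mul_div hx0 hε (hgrowth j hj)
  refine le_of_mul_le_mul_left (hcomp.trans ?_) hfx
  have hinv : (1 - x)⁻¹ = 2 * L := by rw [hx, sub_sub_cancel, inv_inv]
  calc _ ≤ ε * (2 * f x) + ε / L * C * (f x * (1 - x)⁻¹) := add_le_add hhead le_rfl
    _ = f x * ((2 + 2 * C) * ε) := by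
      rw [hinv]
      field_simp

theorem tendsto_of_tendsto_powerMean (h : RenewalWeights d p c C)
    (hf : ∀ x, 0 ≤ x → x < 1 → HasSum (fun j => p j * x ^ j) (f x))
    (hg : ∀ x, 0 ≤ x → x < 1 → HasSum (fun j => (p j * x ^ j) • u j) (f x • g x))
    (hdefect : renewalDefect d p u =o[atTop] fun n => n * p n)
    (hA : Tendsto g (𝓝[<] 1) (𝓝 A)) : Tendsto u atTop (𝓝 A) := by
  have hC := h.upper_pos
  obtain ⟨K, m, hK, hcenter⟩ := h.exists_centers hdefect
  set x : ℕ → ℝ := fun i => 1 - (2 * ((K ^ i : ℕ) : ℝ))⁻¹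
  have hK0 : ∀ i, 1 ≤ K ^ i := fun i => Nat.one_le_pow i K (by lia)
  have hlog : Tendsto (Nat.log K) atTop atTop :=
    tendsto_atTop.2 fun i => (eventually_ge_atTop (K ^ i)).mono fun n hn =>
      Nat.le_log_of_pow_le hK hn
  have hx : Tendsto x atTop (𝓝[<] 1) := by
    have hscale : Tendsto (fun i => 2 * ((K ^ i : ℕ) : ℝ)) atTop atTop :=
      (tendsto_natCast_atTop_atTop.comp (tendsto_pow_atTop_atTop_of_one_lt hK)).const_mul_atTop
        two_pos
    refine tendsto_nhdsWithin_iff.2 ⟨?_, .of_forall fun i =>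
      (one_sub_inv_two_mul_bounds (hK0 i)).2.1⟩
    simpa only [Pi.inv_apply, sub_zero] using hscale.inv_tendsto_atTop.const_sub (1 : ℝ)
  have hgap : Tendsto (fun n => u n - g (x (Nat.log K n))) atTop (𝓝 0) := by
    refine Metric.tendsto_nhds.2 fun ε hε => ?_
    set δ := ε / (K + 2 * C + 3)
    have hδ : 0 < δ := by positivity
    filter_upwards [hlog.eventually (hcenter δ hδ), eventually_ne_atTop 0] with n hn hn0
    obtain ⟨hmean, hgrowth⟩ := hn
    have hpower : ‖g (x (Nat.log K n)) - m (Nat.log K n)‖ ≤ (2 + 2 * C) * δ :=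
      h.norm_sub_powerMean_le hf hg (hK0 _) hδ.le hmean fun j hj => by
        simpa only [Nat.cast_pow] using hgrowth j hj
    have hn_le : (n : ℝ) ≤ K * K ^ Nat.log K n := by
      rw [← pow_succ']
      exact_mod_cast (Nat.lt_pow_succ_log_self hK n).le
    have hpoint : ‖u n - m (Nat.log K n)‖ ≤ δ * K :=
      (hgrowth n (Nat.pow_log_le_self K hn0)).trans <|
        mul_le_mul_of_nonneg_left (div_le_of_le_mul₀ (by positivity) K.cast_nonneg hn_le) hδ.le
    calc dist (u n - g (x (Nat.log K n))) 0
        = ‖(u n - m (Nat.log K n)) - (g (x (Nat.log K n)) - m (Nat.log K n))‖ := by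
          rw [dist_zero_right, sub_sub_sub_cancel_right]
      _ ≤ δ * K + (2 + 2 * C) * δ := (norm_sub_le _ _).trans (add_le_add hpoint hpower)
      _ < δ * (K + 2 * C + 3) := by linarith
      _ = ε := div_mul_cancel₀ ε (by positivity)
  simpa using hgap.add ((hA.comp hx).comp hlog)

end PowerMean

end RenewalWeights

/-- The Voronoi (Nörlund) means `(∑_{k ≤ n} p_{n - k} a_k) / p_n` of the sequence `a` with
weights `p`. -/
noncomputable def voronoiMean {E : Type*} [AddCommMonoid E] [Module ℝ E] (p : ℕ → ℝ) (a : ℕ → E)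
    (n : ℕ) : E :=
  (p n)⁻¹ • ∑ k ∈ Finset.range (n + 1), p (n - k) • a k

namespace RenewalWeights

open Finset

section VoronoiMean

variable {d p : ℕ → ℝ} {c C : ℝ}

theorem smul_voronoiMean {E : Type*} [AddCommMonoid E] [Module ℝ E] (h : RenewalWeights d p c C)
    (a : ℕ → E) (n : ℕ) : p n • voronoiMean p a n = ∑ k ∈ range (n + 1), p (n - k) • a k :=
  smul_inv_smul₀ (h.pos n).ne' _

theorem sum_smul_sum_smul_eq {E : Type*} [AddCommMonoid E] [Module ℝ E]
    (h : RenewalWeights d p c C) (a : ℕ → E) (n : ℕ) :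
    ∑ j ∈ range n, d (n - j) • ∑ k ∈ range (j + 1), p (j - k) • a k
      = ∑ k ∈ range (n + 1), (((n - k : ℕ) : ℝ) * p (n - k)) • a k := by
  simp only [smul_sum, smul_smul]
  rw [sum_comm' (t' := range n) (s' := fun k => Ico k n)
    (by intro j k; simp only [mem_range, mem_Ico]; lia), sum_range_succ, Nat.sub_self,
    Nat.cast_zero, zero_mul, zero_smul, add_zero]
  refine sum_congr rfl fun k _ => ?_
  rw [h.recursion, sum_smul, sum_Ico_eq_sum_range]
  exact sum_congr rfl fun i _ => by rw [Nat.sub_sub, Nat.add_sub_cancel_left]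

theorem renewalDefect_voronoiMean {E : Type*} [AddCommGroup E] [Module ℝ E]
    (h : RenewalWeights d p c C) (a : ℕ → E) (n : ℕ) :
    renewalDefect d p (voronoiMean p a) n
      = ∑ k ∈ range (n + 1), ((k : ℝ) * p (n - k)) • a k := by
  simp only [renewalDefect, mul_smul, h.smul_voronoiMean]
  rw [h.sum_smul_sum_smul_eq, smul_sum, ← sum_sub_distrib]
  refine sum_congr rfl fun k hk => ?_
  rw [smul_smul, ← sub_smul, ← mul_smul, Nat.cast_sub (Nat.lt_succ_iff.1 (mem_range.1 hk))]
  congr 1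
  ring

theorem hasSum_smul_voronoiMean {E : Type*} [NormedAddCommGroup E] [NormedSpace ℝ E]
    [CompleteSpace E] (h : RenewalWeights d p c C) {a : ℕ → E} {g : ℝ → E}
    (hg : ∀ x, 0 ≤ x → x < 1 → HasSum (fun n => x ^ n • a n) (g x)) {x s : ℝ} (hx0 : 0 ≤ x)
    (hx1 : x < 1) (hs : HasSum (fun j => p j * x ^ j) s) :
    HasSum (fun j => (p j * x ^ j) • voronoiMean p a j) (s • g x) := by
  obtain ⟨r, hxr, hr1⟩ := exists_between hx1
  have habs := summable_norm_pow_smul_of_lt hx0 hxr (hg r (hx0.trans hxr.le) hr1).summable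
  refine (hasSum_sum_range_smul_of_summable_norm hs (hg x hx0 hx1) habs).congr_fun fun n => ?_
  rw [mul_comm, mul_smul, h.smul_voronoiMean, smul_sum]
  refine sum_congr rfl fun k hk => ?_
  rw [smul_smul, smul_smul, mul_assoc, ← pow_add,
    Nat.sub_add_cancel (Nat.lt_succ_iff.1 (mem_range.1 hk)), mul_comm]

end VoronoiMean

end RenewalWeights

theorem theorem2_general {E : Type*} [NormedAddCommGroup E] [NormedSpace ℝ E] [CompleteSpace E]
    (a : ℕ → E) (g : ℝ → E)
    (hg : ∀ x : ℝ, 0 ≤ x → x < 1 → HasSum (fun n : ℕ => x ^ n • a n) (g x))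
    (d p : ℕ → ℝ) (dminus dplus : ℝ) (hdminus : 0 < dminus)
    (hd : ∀ k : ℕ, 1 ≤ k → dminus ≤ d k ∧ d k ≤ dplus)
    (hp : ∀ z : ℂ, ‖z‖ < 1 →
      HasSum (fun j : ℕ => (p j : ℂ) * z ^ j)
        (Complex.exp (∑' k : ℕ, (d (k + 1) : ℂ) / ((k + 1 : ℕ) : ℂ) * z ^ (k + 1))))
    (A : E) :
    Tendsto (voronoiMean p a) atTop (𝓝 A) ↔
      Tendsto g (𝓝[<] (1 : ℝ)) (𝓝 A) ∧
      (fun n : ℕ => ∑ k ∈ Finset.range (n + 1), ((k : ℝ) * p (n - k)) • a k)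
        =o[atTop] (fun n : ℕ => (n : ℝ) * p n) := by
  have h := RenewalWeights.of_hasSum_exp hdminus hd hp
  have hf : ∀ x : ℝ, 0 ≤ x → x < 1 → HasSum (fun j => p j * x ^ j) (∑' j, p j * x ^ j) := by
    intro x hx0 hx1
    have hpx := (hp x (by rwa [Complex.norm_of_nonneg hx0])).summable
    exact Summable.hasSum (by exact_mod_cast hpx)
  have hmean := fun x hx0 hx1 => h.hasSum_smul_voronoiMean hg hx0 hx1 (hf x hx0 hx1)
  rw [← funext (h.renewalDefect_voronoiMean a)]
  exact ⟨fun hu => ⟨h.tendsto_powerMean hf hmean hu, h.isLittleO_renewalDefect hu⟩,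
    fun ⟨hgA, hdefect⟩ => h.tendsto_of_tendsto_powerMean hf hmean hdefect hgA⟩

theorem theorem2 (a : ℕ → ℂ) (g : ℂ → ℂ)
    (hg : ∀ z : ℂ, ‖z‖ < 1 → HasSum (fun n : ℕ => a n * z ^ n) (g z))
    (d p : ℕ → ℝ) (dminus dplus : ℝ) (hdminus : 0 < dminus)
    (hd : ∀ k : ℕ, 1 ≤ k → dminus ≤ d k ∧ d k ≤ dplus)
    (hp : ∀ z : ℂ, ‖z‖ < 1 →
      HasSum (fun j : ℕ => (p j : ℂ) * z ^ j)
        (Complex.exp (∑' k : ℕ, (d (k + 1) : ℂ) / ((k + 1 : ℕ) : ℂ) * z ^ (k + 1))))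
    (A : ℂ) :
    Tendsto
        (fun n : ℕ => (1 / (p n : ℂ)) * ∑ k ∈ Finset.range (n + 1), a k * (p (n - k) : ℂ))
        atTop (𝓝 A) ↔
      Tendsto (fun x : ℝ => g (x : ℂ)) (𝓝[<] (1 : ℝ)) (𝓝 A) ∧
      (fun n : ℕ => ∑ k ∈ Finset.range (n + 1), a k * (k : ℂ) * (p (n - k) : ℂ))
        =o[atTop] (fun n : ℕ => (n : ℝ) * p n) := by
  have hmean : voronoiMean p a =
      fun n => (1 / (p n : ℂ)) * ∑ k ∈ Finset.range (n + 1), a k * (p (n - k) : ℂ) := by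
    ext n
    simp [voronoiMean, mul_comm]
  rw [← hmean]
  simpa [mul_comm, mul_left_comm, mul_assoc] using theorem2_general a (fun x => g x)
    (fun x hx0 hx1 => by simpa [mul_comm] using hg x (by rwa [Complex.norm_of_nonneg hx0]))
    d p dminus dplus hdminus hd hp A
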